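/- Let $P(s),C(s)$ be real rational (not necessarily proper) transfer functions in one variable. For $N\ge 1$ let $B_N\in\mathbb{R}^{N\times N}$ be the matrix with $1$ on the diagonal, $-1$ on the first superdiagonal and $0$ elsewhere, let $L_N=B_N^{T}B_N$ (the tridiagonal matrix with diagonal $1,2,\dots,2$ and off-diagonal entries $-1$), and let $$S_N(s)=\big[(I+P(s)C(s)L_N)^{-1}\big]_{1,1}.$$ Let $\mathscr{H}_\infty$ denote the space of functions that are analytic and bounded on the open right half plane. Suppose that for every $k\in(0,4)$ the function $1+kPC$ is not identically zero and $$\frac{1}{1+kP(s)C(s)}\in\mathscr{H}_\infty .$$ Then for every $N\ge 1$ the matrix $I+PCL_N$ is invertible over the field of real rational functions and $S_N\in\mathscr{H}_\infty$. If in addition $PC$ has at least two more poles than zeros (relative degree at least two; the zero function is counted as having infinite relative degree), then for every $N\ge 1$ the function $\omega\mapsto\ln|S_N(j\omega)|$ is integrable on $(0,\infty)$ and $$\int_0^\infty \ln|S_N(j\omega)|\,d\omega=0 .$$ -/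

import Mathlib

open MeasureTheory Set

noncomputable section

namespace StringNetwork

/-- The class of real rational, not necessarily proper, transfer functions in one variable. -/
abbrev TransferFunction : Type := RatFunc ℝ

/-- The value `G(s)` of a transfer function at a complex number `s` which is not a pole of `G`,
computed from the reduced fraction representing `G`
(at the finitely many poles it is the conventional value `0`). -/
def value (G : TransferFunction) (s : ℂ) : ℂ :=
  RatFunc.eval (algebraMap ℝ ℂ) s G

/-- The Hardy space `H∞` of the open right half plane: functions which are holomorphic on
`{s | 0 < Re s}` and have finite supremum norm there. -/
def MemHInfty (f : ℂ → ℂ) : Prop :=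
  DifferentiableOn ℂ f {s : ℂ | 0 < s.re} ∧ ∃ M : ℝ, ∀ s : ℂ, 0 < s.re → ‖f s‖ ≤ M

/-- A transfer function has at least `r` more poles than zeros, counted with multiplicity, that is,
relative degree at least `r`. The zero function has infinite relative degree (the degree of the zero
polynomial is `⊥`). -/
def RelativeDegreeAtLeast (r : ℕ) (G : TransferFunction) : Prop :=
  G.num.degree + (r : WithBot ℕ) ≤ G.denom.degree

/-- The `N × N` matrix with `1` on the diagonal, `-1` on the first superdiagonal, `0` elsewhere. -/
def B (N : ℕ) : Matrix (Fin N) (Fin N) ℝ :=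
  Matrix.of fun i j => if i = j then 1 else if (i : ℕ) + 1 = (j : ℕ) then -1 else 0

/-- The matrix `L_N = B_Nᵀ B_N`: tridiagonal, `-1` off the diagonal, diagonal `1, 2, …, 2`. -/
def L (N : ℕ) : Matrix (Fin N) (Fin N) ℝ :=
  (B N).transpose * B N

/-- The matrix of transfer functions `I + P C L_N`. -/
def returnDifference (P C : TransferFunction) (N : ℕ) :
    Matrix (Fin N) (Fin N) TransferFunction :=
  1 + (P * C) • (L N).map (RatFunc.C : ℝ →+* RatFunc ℝ)

/-- The `(1,1)` entry `S_N` of the inverse, over the field of transfer functions, of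
`I + P C L_N`, for `N ≥ 1`. -/
def S (P C : TransferFunction) (N : ℕ) [NeZero N] : TransferFunction :=
  (returnDifference P C N)⁻¹ 0 0

end StringNetwork

end

/-!
Write `G = P C = n / d` in lowest terms and `T_k = 1 / (1 + k G) = d / (d + k n)`.

The matrix `L_N` is real symmetric, and both `L_N` and its minor without the first row and column
have all eigenvalues in `(0, 4)`, since `L_N` and `4 - L_N` are positive definite
(`posDef_L`, `posDef_four_sub_L`). Diagonalizing `L_N` by a real orthogonal matrix shows that
`det (1 + G L_N) = ∏ (1 + λ_i G)` and that `S_N` is a real linear combination of the functions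
`T_{λ_i}`, so it lies in `H∞` (`memHInfty_S`). Cramer's rule gives in addition
`S_N = ∏ T_{λ_i} / ∏ T_{μ_j}`, where the `μ_j` are the eigenvalues of the minor
(`S_mul_prod_eigenvalues`). Up to finitely many frequencies, `log |S_N|` is therefore a sum of terms
`± log |T_k|` with `k` in `(0, 4)`, and it is enough to integrate `log |T_k|`.

For relative degree at least two, `d` and `d + k n` are monic of the same degree with the same
second coefficient. The roots of `d + k n` are poles of the bounded function `T_k`, so they lie in the
closed left half plane; letting `k → 0`, the roots of `d` do too
(`denom_eval₂_ne_zero_of_closedLoop`). This is where the hypothesis for small `k` is used: an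
unstable pole of `G` would make the integral positive.

The integral itself is computed root by root, without contour integration. For `Re a ≤ 0`,
`∫_{-R}^{R} log |iω - a| dω = 2 R log R - 2 R - π Re a + o(1)`
(`tendsto_integral_log_norm_I_mul_sub`). Summing over the roots of `d` and of `d + k n`, the
divergent terms cancel because the degrees agree, and the constants cancel because the sums of the
roots agree (`integral_log_norm_sub_log_norm`).
-/

namespace StringNetwork

open Filter Topology

/-! ### Real symmetric matrices over an extension of the reals -/

section Spectral

variable {m : Type*} [Fintype m] [DecidableEq m]

theorem eigenvalues_lt_of_posDef_sub {M : Matrix m m ℝ} (hM : M.IsHermitian) {c : ℝ}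
    (h : (c • (1 : Matrix m m ℝ) - M).PosDef) (i : m) : hM.eigenvalues i < c := by
  have hv := hM.mulVec_eigenvectorBasis i
  set v : m → ℝ := ⇑(hM.eigenvectorBasis i)
  have hv0 : v ≠ 0 := by
    intro h0
    have h1 := hM.eigenvectorBasis.orthonormal.ne_zero i
    apply h1
    ext j
    exact congrFun h0 j
  have hpos := h.dotProduct_mulVec_pos hv0
  rw [Matrix.sub_mulVec, hv, Matrix.smul_mulVec, Matrix.one_mulVec, ← sub_smul,
    dotProduct_smul, smul_eq_mul] at hpos
  have h2 : 0 ≤ star v ⬝ᵥ v := dotProduct_star_self_nonneg v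
  by_contra hcon
  push Not at hcon
  nlinarith

/-- Over any field extending `ℝ`, the matrix `1 + g M` with `M` real symmetric is diagonalized by
the real orthogonal matrix which diagonalizes `M`. -/
theorem exists_diagonalization_one_add_smul {K : Type*} [Field K] (f : ℝ →+* K) (g : K)
    {M : Matrix m m ℝ} (hM : M.IsHermitian) :
    ∃ U V : Matrix m m ℝ, U.map f * V.map f = 1 ∧
      1 + g • M.map f =
        U.map f * Matrix.diagonal (fun i => 1 + f (hM.eigenvalues i) * g) * V.map f := by
  let U₀ : Matrix m m ℝ := hM.eigenvectorUnitary
  have hUV : U₀ * star U₀ = 1 := Unitary.coe_mul_star_self hM.eigenvectorUnitary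
  have hspec : M = U₀ * Matrix.diagonal hM.eigenvalues * star U₀ := by
    have := hM.spectral_theorem
    rw [Unitary.conjStarAlgAut_apply] at this
    exact this
  have hUV' : U₀.map f * (star U₀).map f = 1 := by
    rw [← Matrix.map_mul, hUV, Matrix.map_one f f.map_zero f.map_one]
  refine ⟨U₀, star U₀, hUV', ?_⟩
  have hdiag : Matrix.diagonal (fun i => 1 + f (hM.eigenvalues i) * g) =
      1 + g • (Matrix.diagonal hM.eigenvalues).map f := by
    ext i j
    by_cases hij : i = j
    · subst hij; simp [mul_comm]
    · simp [hij]
  rw [hdiag, mul_add, add_mul, mul_one, hUV', Matrix.mul_smul, Matrix.smul_mul,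
    ← Matrix.map_mul, ← Matrix.map_mul, ← hspec]

theorem det_one_add_smul_map {K : Type*} [Field K] (f : ℝ →+* K) (g : K)
    {M : Matrix m m ℝ} (hM : M.IsHermitian) :
    (1 + g • M.map f).det = ∏ i, (1 + f (hM.eigenvalues i) * g) := by
  obtain ⟨U, V, hUV, h⟩ := exists_diagonalization_one_add_smul f g hM
  have hdet : (U.map f).det * (V.map f).det = 1 := by rw [← Matrix.det_mul, hUV, Matrix.det_one]
  rw [h, Matrix.det_mul, Matrix.det_mul, Matrix.det_diagonal, mul_right_comm, hdet, one_mul]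

/-- A diagonal entry of `(1 + g M)⁻¹` is a combination of the functions `1 / (1 + λ_i g)` whose
coefficients come from the base field `ℝ`. -/
theorem exists_inv_one_add_smul_map_apply {K : Type*} [Field K] (f : ℝ →+* K) (g : K)
    {M : Matrix m m ℝ} (hM : M.IsHermitian)
    (hne : ∀ i, 1 + f (hM.eigenvalues i) * g ≠ 0) (j : m) :
    ∃ c : m → ℝ, (1 + g • M.map f)⁻¹ j j =
      ∑ i, f (c i) * (1 / (1 + f (hM.eigenvalues i) * g)) := by
  obtain ⟨U, V, hUV, h⟩ := exists_diagonalization_one_add_smul f g hM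
  have hVU : V.map f * U.map f = 1 := mul_eq_one_comm.mp hUV
  set d : m → K := fun i => 1 + f (hM.eigenvalues i) * g with hd
  have hdd : Matrix.diagonal d * Matrix.diagonal (fun i => 1 / d i) = 1 := by
    rw [Matrix.diagonal_mul_diagonal, ← Matrix.diagonal_one]
    congr 1
    funext i
    exact mul_one_div_cancel (hne i)
  have hinv : (1 + g • M.map f)⁻¹ =
      U.map f * Matrix.diagonal (fun i => 1 / d i) * V.map f := by
    refine Matrix.inv_eq_right_inv ?_
    rw [h]
    calc U.map f * Matrix.diagonal d * V.map f *
          (U.map f * Matrix.diagonal (fun i => 1 / d i) * V.map f)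
        = U.map f * (Matrix.diagonal d * ((V.map f * U.map f) *
            Matrix.diagonal (fun i => 1 / d i))) * V.map f := by simp only [Matrix.mul_assoc]
      _ = 1 := by rw [hVU, one_mul, hdd, mul_one, hUV]
  refine ⟨fun i => U j i * V i j, ?_⟩
  rw [hinv, Matrix.mul_apply]
  refine Finset.sum_congr rfl fun i _ => ?_
  rw [Matrix.mul_diagonal, Matrix.map_apply, Matrix.map_apply, map_mul]
  ring

end Spectral

/-! ### The chain matrix and its eigenvalues -/

section ChainMatrix

theorem isHermitian_L (N : ℕ) : (L N).IsHermitian := by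
  have := Matrix.isHermitian_conjTranspose_mul_self (B N)
  rwa [Matrix.conjTranspose_eq_transpose_of_trivial] at this

theorem injective_mulVec_of_unitriangular {N : ℕ} {A : Matrix (Fin N) (Fin N) ℝ}
    (hA : A.BlockTriangular id) (hd : ∀ i, A i i = 1) : Function.Injective A.mulVec := by
  rw [Matrix.mulVec_injective_iff_isUnit, Matrix.isUnit_iff_isUnit_det,
    Matrix.det_of_isUpperTriangular hA]
  simp [hd]

theorem posDef_transpose_mul_self {N : ℕ} {A : Matrix (Fin N) (Fin N) ℝ}
    (hA : A.BlockTriangular id) (hd : ∀ i, A i i = 1) : (A.transpose * A).PosDef := by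
  have := Matrix.PosDef.conjTranspose_mul_self A (injective_mulVec_of_unitriangular hA hd)
  rwa [Matrix.conjTranspose_eq_transpose_of_trivial] at this

theorem posDef_L (N : ℕ) : (L N).PosDef := by
  refine posDef_transpose_mul_self ?_ ?_
  · intro i j hij
    have hij' : (j : ℕ) < i := hij
    have h1 : i ≠ j := by rintro rfl; exact lt_irrefl _ hij'
    have h2 : (i : ℕ) + 1 ≠ j := by omega
    simp [B, h1, h2]
  · intro i; simp [B]

/-- With `U` the nilpotent shift, `4 - (1 - U)ᵀ(1 - U) = (1 + U)ᵀ(1 + U) + 2(1 - UᵀU)`, where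
`1 + U` is invertible and `1 - UᵀU` is the projection onto the first coordinate. -/
theorem posDef_four_sub_L (N : ℕ) : ((4 : ℝ) • (1 : Matrix (Fin N) (Fin N) ℝ) - L N).PosDef := by
  let U : Matrix (Fin N) (Fin N) ℝ := Matrix.of fun i j => if (i : ℕ) + 1 = (j : ℕ) then 1 else 0
  have hB : B N = 1 - U := by
    ext i j
    by_cases hij : i = j
    · subst hij; simp [B, U]
    · by_cases h : (i : ℕ) + 1 = j <;> simp [B, U, hij, h]
  have hUU : U.transpose * U =
      Matrix.diagonal fun i : Fin N => if (i : ℕ) = 0 then (0 : ℝ) else 1 := by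
    ext i j
    simp only [Matrix.mul_apply, Matrix.transpose_apply, U, Matrix.of_apply, mul_ite, mul_one,
      mul_zero, Matrix.diagonal_apply]
    by_cases hij : i = j
    · subst hij
      by_cases h0 : (i : ℕ) = 0
      · simp [h0]
      · simp only [h0, if_true, if_false]
        rw [Finset.sum_eq_single (⟨(i : ℕ) - 1, by omega⟩ : Fin N)]
        · have : (i : ℕ) - 1 + 1 = i := by omega
          simp [this]
        · intro b _ hb
          have : (b : ℕ) + 1 ≠ i := fun h => hb (Fin.ext (by simp; omega))
          simp [this]
        · simp
    · rw [if_neg hij]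
      refine Finset.sum_eq_zero fun k _ => ?_
      by_cases h1 : (k : ℕ) + 1 = j
      · have : (k : ℕ) + 1 ≠ i := fun h => hij (Fin.ext (by omega))
        simp [this]
      · simp [h1]
  have key : (4 : ℝ) • (1 : Matrix (Fin N) (Fin N) ℝ) - L N =
      (1 + U).transpose * (1 + U) + (2 : ℝ) • (1 - U.transpose * U) := by
    rw [L, hB, Matrix.transpose_sub, Matrix.transpose_add, Matrix.transpose_one]
    simp only [sub_mul, mul_sub, add_mul, mul_add, one_mul, mul_one, smul_sub]
    module
  rw [key]
  refine Matrix.PosDef.add_posSemidef (posDef_transpose_mul_self ?_ ?_) ?_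
  · intro i j hij
    have hij' : (j : ℕ) < i := hij
    have h1 : i ≠ j := by rintro rfl; exact lt_irrefl _ hij'
    have h2 : (i : ℕ) + 1 ≠ j := by omega
    simp [U, h1, h2]
  · intro i; simp [U]
  · have : (1 : Matrix (Fin N) (Fin N) ℝ) - U.transpose * U =
        Matrix.diagonal fun i : Fin N => if (i : ℕ) = 0 then (1 : ℝ) else 0 := by
      rw [hUU]
      ext i j
      by_cases hij : i = j
      · subst hij; by_cases h : (i : ℕ) = 0 <;> simp [h]
      · simp [hij]
    rw [this]
    refine Matrix.PosSemidef.smul (Matrix.PosSemidef.diagonal fun i => ?_) (by norm_num)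
    by_cases h : (i : ℕ) = 0 <;> simp [h]

theorem eigenvalues_L_mem (N : ℕ) (i : Fin N) : (isHermitian_L N).eigenvalues i ∈ Ioo (0 : ℝ) 4 :=
  ⟨(posDef_L N).eigenvalues_pos i, eigenvalues_lt_of_posDef_sub _ (posDef_four_sub_L N) i⟩

theorem isHermitian_L_minor (n : ℕ) : ((L (n + 1)).submatrix Fin.succ Fin.succ).IsHermitian :=
  (isHermitian_L (n + 1)).submatrix _

theorem eigenvalues_L_minor_mem (n : ℕ) (i : Fin n) :
    (isHermitian_L_minor n).eigenvalues i ∈ Ioo (0 : ℝ) 4 := by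
  refine ⟨((posDef_L (n + 1)).submatrix (Fin.succ_injective n)).eigenvalues_pos i,
    eigenvalues_lt_of_posDef_sub _ ?_ i⟩
  have := (posDef_four_sub_L (n + 1)).submatrix (Fin.succ_injective n)
  rwa [Matrix.submatrix_sub, Pi.sub_apply, Pi.sub_apply, Matrix.submatrix_smul,
    Pi.smul_apply, Pi.smul_apply, Matrix.submatrix_one _ (Fin.succ_injective n)] at this

theorem det_returnDifference (P C : TransferFunction) (N : ℕ) :
    (returnDifference P C N).det =
      ∏ i, (1 + RatFunc.C ((isHermitian_L N).eigenvalues i) * (P * C)) :=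
  det_one_add_smul_map RatFunc.C (P * C) (isHermitian_L N)

/-- Cramer's rule: the numerator of `S_N` is the determinant of the minor obtained by deleting the
first row and column, which is again of the form `1 + P C M` with `M` real symmetric. -/
theorem S_mul_prod_eigenvalues (P C : TransferFunction) (n : ℕ)
    (h : (returnDifference P C (n + 1)).det ≠ 0) :
    S P C (n + 1) * ∏ i, (1 + RatFunc.C ((isHermitian_L (n + 1)).eigenvalues i) * (P * C)) =
      ∏ i, (1 + RatFunc.C ((isHermitian_L_minor n).eigenvalues i) * (P * C)) := by
  rw [← det_returnDifference, ← det_one_add_smul_map RatFunc.C (P * C) (isHermitian_L_minor n), S,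
    Matrix.inv_def, Matrix.smul_apply, Ring.inverse_eq_inv', smul_eq_mul, mul_right_comm,
    inv_mul_cancel₀ h, one_mul, Matrix.adjugate_fin_succ_eq_det_submatrix]
  simp only [Fin.val_zero, add_zero, pow_zero, one_mul, Fin.succAbove_zero]
  congr 1
  ext i j : 1
  simp [returnDifference, Matrix.one_apply]

end ChainMatrix

/-! ### Rational functions in `H∞` -/

theorem eventually_eval₂_ne_zero {p : Polynomial ℝ} (hp : p ≠ 0) (s : ℂ) :
    ∀ᶠ z in 𝓝[≠] s, p.eval₂ (algebraMap ℝ ℂ) z ≠ 0 := by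
  have hp' : p.map (algebraMap ℝ ℂ) ≠ 0 :=
    (Polynomial.map_ne_zero_iff (algebraMap ℝ ℂ).injective).mpr hp
  have hfin : ((p.map (algebraMap ℝ ℂ)).roots.toFinset : Set ℂ).Finite := Finset.finite_toSet _
  have : ∀ᶠ z in 𝓝[≠] s, z ∉ ((p.map (algebraMap ℝ ℂ)).roots.toFinset : Set ℂ) := by
    have h1 := (hfin.subset (sdiff_subset (t := {s}))).isClosed.compl_mem_nhds
      (show s ∉ _ \ {s} by simp)
    filter_upwards [mem_nhdsWithin_of_mem_nhds h1, self_mem_nhdsWithin] with z hz hzs hz'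
    exact hz ⟨hz', hzs⟩
  filter_upwards [this] with z hz h0
  apply hz
  rw [Finset.mem_coe, Multiset.mem_toFinset, Polynomial.mem_roots hp', Polynomial.IsRoot,
    Polynomial.eval_map]
  exact h0

theorem continuous_eval₂ (p : Polynomial ℝ) :
    Continuous fun z : ℂ => p.eval₂ (algebraMap ℝ ℂ) z := by
  simp only [← Polynomial.eval_map]
  exact (p.map (algebraMap ℝ ℂ)).continuous

theorem eval₂_ne_zero_of_isCoprime {p q : Polynomial ℝ} (h : IsCoprime p q) {s : ℂ}
    (hq : q.eval₂ (algebraMap ℝ ℂ) s = 0) : p.eval₂ (algebraMap ℝ ℂ) s ≠ 0 := by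
  obtain ⟨a, b, hab⟩ := h
  intro hp
  have := congrArg (Polynomial.eval₂ (algebraMap ℝ ℂ) s) hab
  simp [Polynomial.eval₂_add, Polynomial.eval₂_mul, hp, hq] at this

/-- A bounded rational function has no poles in the half plane: near a pole the reduced numerator
would be at most a multiple of the denominator, hence vanish with it. -/
theorem MemHInfty.denom_ne_zero {G : TransferFunction} (hG : MemHInfty (value G)) {s : ℂ}
    (hs : 0 < s.re) : G.denom.eval₂ (algebraMap ℝ ℂ) s ≠ 0 := by
  intro h0
  obtain ⟨-, M, hM⟩ := hG
  refine eval₂_ne_zero_of_isCoprime G.isCoprime_num_denom h0 ?_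
  have hle : ∀ᶠ z in 𝓝[≠] s, ‖G.num.eval₂ (algebraMap ℝ ℂ) z‖ ≤
      M * ‖G.denom.eval₂ (algebraMap ℝ ℂ) z‖ := by
    have hre : ∀ᶠ z in 𝓝[≠] s, 0 < z.re :=
      mem_nhdsWithin_of_mem_nhds ((isOpen_lt continuous_const Complex.continuous_re).mem_nhds hs)
    filter_upwards [eventually_eval₂_ne_zero G.denom_ne_zero s, hre] with z hz hzre
    have := hM z hzre
    rwa [value, RatFunc.eval, norm_div, div_le_iff₀ (norm_pos_iff.mpr hz)] at this
  have h1 := ((continuous_eval₂ G.num).norm.tendsto s).mono_left (nhdsWithin_le_nhds (s := {s}ᶜ))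
  have h2 := (((continuous_eval₂ G.denom).norm.const_mul M).tendsto s).mono_left
    (nhdsWithin_le_nhds (s := {s}ᶜ))
  have := le_of_tendsto_of_tendsto h1 h2 hle
  rw [h0, norm_zero, mul_zero] at this
  exact norm_le_zero_iff.mp this

theorem MemHInfty.value_add {F G : TransferFunction} (hF : MemHInfty (value F))
    (hG : MemHInfty (value G)) : MemHInfty (value (F + G)) := by
  have hadd : ∀ z : ℂ, 0 < z.re → value (F + G) z = value F z + value G z := fun z hz =>
    RatFunc.eval_add _ _ (hF.denom_ne_zero hz) (hG.denom_ne_zero hz)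
  obtain ⟨M, hM⟩ := hF.2
  obtain ⟨M', hM'⟩ := hG.2
  refine ⟨(hF.1.add hG.1).congr hadd, M + M', fun z hz => ?_⟩
  rw [hadd z hz]
  exact norm_add_le_of_le (hM z hz) (hM' z hz)

theorem MemHInfty.value_mul {F G : TransferFunction} (hF : MemHInfty (value F))
    (hG : MemHInfty (value G)) : MemHInfty (value (F * G)) := by
  have hmul : ∀ z : ℂ, 0 < z.re → value (F * G) z = value F z * value G z := fun z hz =>
    RatFunc.eval_mul _ _ (hF.denom_ne_zero hz) (hG.denom_ne_zero hz)
  obtain ⟨M, hM⟩ := hF.2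
  obtain ⟨M', hM'⟩ := hG.2
  refine ⟨(hF.1.mul hG.1).congr hmul, M * M', fun z hz => ?_⟩
  rw [hmul z hz, norm_mul]
  exact mul_le_mul (hM z hz) (hM' z hz) (norm_nonneg _) ((norm_nonneg _).trans (hM z hz))

theorem MemHInfty.value_C (c : ℝ) : MemHInfty (value (RatFunc.C c)) := by
  have : value (RatFunc.C c) = fun _ => (c : ℂ) := by funext z; simp [value]
  rw [this]
  exact ⟨differentiableOn_const _, ‖(c : ℂ)‖, fun _ _ => le_rfl⟩

theorem MemHInfty.value_sum {ι : Type*} (t : Finset ι) (F : ι → TransferFunction)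
    (h : ∀ i ∈ t, MemHInfty (value (F i))) : MemHInfty (value (∑ i ∈ t, F i)) := by
  classical
  refine Finset.sum_induction F (fun G => MemHInfty (value G)) (fun _ _ => value_add) ?_ h
  simpa using value_C 0

/-! ### Location of the closed-loop and open-loop poles -/

/-- The denominator `d + k n` of `1 / (1 + k G)`, where `G = n / d` in lowest terms. -/
noncomputable def closedLoop (G : TransferFunction) (k : ℝ) : Polynomial ℝ :=
  G.denom + Polynomial.C k * G.num

theorem one_add_C_mul_mul_denom (G : TransferFunction) (k : ℝ) :
    (1 + RatFunc.C k * G) * algebraMap _ (RatFunc ℝ) G.denom =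
      algebraMap _ (RatFunc ℝ) (closedLoop G k) := by
  have hd : algebraMap _ (RatFunc ℝ) G.denom ≠ 0 := RatFunc.algebraMap_ne_zero G.denom_ne_zero
  conv_lhs => enter [1, 2, 2]; rw [← RatFunc.num_div_denom G]
  rw [closedLoop, map_add, map_mul, RatFunc.algebraMap_C]
  field_simp

theorem closedLoop_ne_zero {G : TransferFunction} {k : ℝ} (h : 1 + RatFunc.C k * G ≠ 0) :
    closedLoop G k ≠ 0 := by
  intro h0
  have := one_add_C_mul_mul_denom G k
  rw [h0, map_zero] at this
  exact mul_ne_zero h (RatFunc.algebraMap_ne_zero G.denom_ne_zero) this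

/-- Since `n` and `d` are coprime, so are `d` and `d + k n`; hence every root of `d + k n` is a
genuine pole of `1 / (1 + k G)`. -/
theorem closedLoop_eval₂_ne_zero {G : TransferFunction} {k : ℝ} (hk : k ≠ 0)
    (h : 1 + RatFunc.C k * G ≠ 0) (hH : MemHInfty (value (1 / (1 + RatFunc.C k * G)))) {s : ℂ}
    (hs : 0 < s.re) : (closedLoop G k).eval₂ (algebraMap ℝ ℂ) s ≠ 0 := by
  intro h0
  have hden := hH.denom_ne_zero hs
  set T := 1 / (1 + RatFunc.C k * G) with hT
  have hq := closedLoop_ne_zero h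
  have hTeq : T = algebraMap _ (RatFunc ℝ) G.denom / algebraMap _ (RatFunc ℝ) (closedLoop G k) := by
    rw [hT, ← one_add_C_mul_mul_denom]
    have := RatFunc.algebraMap_ne_zero G.denom_ne_zero
    field_simp
  have hcross : T.num * closedLoop G k = G.denom * T.denom :=
    (RatFunc.num_mul_eq_mul_denom_iff hq).mpr hTeq
  have hev := congrArg (Polynomial.eval₂ (algebraMap ℝ ℂ) s) hcross
  rw [Polynomial.eval₂_mul, Polynomial.eval₂_mul, h0, mul_zero] at hev
  have hd0 : G.denom.eval₂ (algebraMap ℝ ℂ) s = 0 := by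
    rcases mul_eq_zero.mp hev.symm with h | h
    · exact h
    · exact absurd h hden
  refine eval₂_ne_zero_of_isCoprime G.isCoprime_num_denom hd0 ?_
  have hk' : (k : ℂ) ≠ 0 := by exact_mod_cast hk
  simpa [closedLoop, Polynomial.eval₂_add, Polynomial.eval₂_mul, hd0, hk'] using h0

theorem RelativeDegreeAtLeast.degree_num_lt {G : TransferFunction}
    (hG : RelativeDegreeAtLeast 2 G) (k : ℝ) :
    (Polynomial.C k * G.num).degree + 2 ≤ G.denom.degree := by
  refine le_trans ?_ hG
  have : (Polynomial.C k * G.num).degree ≤ G.num.degree := by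
    rw [← Polynomial.smul_eq_C_mul]; exact Polynomial.degree_smul_le _ _
  exact add_le_add_left this _

theorem degree_lt_of_degree_add_two_le {p q : Polynomial ℝ} (h : p.degree + 2 ≤ q.degree)
    (hq : q ≠ 0) : p.degree < q.degree := by
  by_cases hp : p = 0
  · rw [hp, Polynomial.degree_zero]; exact bot_lt_iff_ne_bot.mpr (Polynomial.degree_ne_bot.mpr hq)
  · rw [Polynomial.degree_eq_natDegree hp, Polynomial.degree_eq_natDegree hq] at *
    have : p.natDegree + 2 ≤ q.natDegree := by exact_mod_cast h
    exact_mod_cast (by omega : p.natDegree < q.natDegree)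

theorem RelativeDegreeAtLeast.closedLoop_monic {G : TransferFunction}
    (hG : RelativeDegreeAtLeast 2 G) (k : ℝ) : (closedLoop G k).Monic :=
  G.monic_denom.add_of_left
    (degree_lt_of_degree_add_two_le (hG.degree_num_lt k) G.denom_ne_zero)

theorem RelativeDegreeAtLeast.closedLoop_natDegree {G : TransferFunction}
    (hG : RelativeDegreeAtLeast 2 G) (k : ℝ) : (closedLoop G k).natDegree = G.denom.natDegree :=
  Polynomial.natDegree_eq_of_degree_eq (Polynomial.degree_add_eq_left_of_degree_lt
    (degree_lt_of_degree_add_two_le (hG.degree_num_lt k) G.denom_ne_zero))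

/-- A monic polynomial with all its roots in the closed left half plane satisfies
`(Re s) ^ deg p ≤ ‖p(s)‖` on the open right half plane. -/
theorem re_pow_natDegree_le_norm_eval {p : Polynomial ℂ} (hp : p.Monic)
    (hroots : ∀ a ∈ p.roots, a.re ≤ 0) {s : ℂ} (hs : 0 < s.re) :
    s.re ^ p.natDegree ≤ ‖p.eval s‖ := by
  have hsplit := IsAlgClosed.splits p
  have hcard : p.roots.card = p.natDegree := hsplit.natDegree_eq_card_roots.symm
  have hprod : p = (p.roots.map fun a => Polynomial.X - Polynomial.C a).prod :=
    hsplit.eq_prod_roots_of_monic hp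
  rw [← hcard]
  conv_rhs => rw [hprod]
  generalize p.roots = t at hroots
  induction t using Multiset.induction_on with
  | empty => simp
  | cons a t ih =>
    have h1 := ih fun b hb => hroots b (Multiset.mem_cons_of_mem hb)
    have h2 : s.re ≤ ‖s - a‖ := by
      have := (le_abs_self _).trans (Complex.abs_re_le_norm (s - a))
      have h3 := hroots a (Multiset.mem_cons_self a t)
      rw [Complex.sub_re] at this
      linarith
    rw [Multiset.card_cons, Multiset.map_cons, Multiset.prod_cons, Polynomial.eval_mul, norm_mul,
      pow_succ']
    simp only [Polynomial.eval_sub, Polynomial.eval_X, Polynomial.eval_C]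
    exact mul_le_mul h2 h1 (pow_nonneg hs.le _) (norm_nonneg _)

/-- `G` has no poles in the open right half plane: at such a pole `s` one has
`d(s) + k n(s) = k n(s) → 0` as `k → 0`, while `‖d(s) + k n(s)‖ ≥ (Re s) ^ deg d` because the roots
of `d + k n` lie in the closed left half plane. -/
theorem denom_eval₂_ne_zero_of_closedLoop {G : TransferFunction}
    (hG : RelativeDegreeAtLeast 2 G)
    (h : ∀ k ∈ Ioo (0 : ℝ) 4, ∀ s : ℂ, 0 < s.re →
      (closedLoop G k).eval₂ (algebraMap ℝ ℂ) s ≠ 0) {s : ℂ} (hs : 0 < s.re) :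
    G.denom.eval₂ (algebraMap ℝ ℂ) s ≠ 0 := by
  intro h0
  have hle : ∀ᶠ k : ℝ in 𝓝[>] 0, s.re ^ G.denom.natDegree ≤
      k * ‖G.num.eval₂ (algebraMap ℝ ℂ) s‖ := by
    filter_upwards [Ioo_mem_nhdsGT (show (0 : ℝ) < 4 by norm_num)] with k hk
    have h1 := re_pow_natDegree_le_norm_eval ((hG.closedLoop_monic k).map (algebraMap ℝ ℂ))
      (fun a ha => by
        by_contra hcon
        push Not at hcon
        refine h k hk a hcon ?_
        rw [← Polynomial.eval_map]
        exact (Polynomial.mem_roots'.mp ha).2) hs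
    rw [Polynomial.natDegree_map, hG.closedLoop_natDegree, Polynomial.eval_map] at h1
    refine h1.trans (le_of_eq ?_)
    simp [closedLoop, Polynomial.eval₂_add, Polynomial.eval₂_mul, h0, abs_of_pos hk.1]
  have hlim : Tendsto (fun k : ℝ => k * ‖G.num.eval₂ (algebraMap ℝ ℂ) s‖) (𝓝[>] 0) (𝓝 0) := by
    have := ((continuous_id (X := ℝ)).mul_const ‖G.num.eval₂ (algebraMap ℝ ℂ) s‖).tendsto 0
    simp only [id, zero_mul] at this
    exact this.mono_left nhdsWithin_le_nhds
  exact absurd (ge_of_tendsto hlim hle) (not_le.mpr (pow_pos hs _))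

theorem memHInfty_S {P C : TransferFunction}
    (h : ∀ k ∈ Ioo (0 : ℝ) 4, 1 + RatFunc.C k * (P * C) ≠ 0 ∧
      MemHInfty (value (1 / (1 + RatFunc.C k * (P * C))))) (N : ℕ) [NeZero N] :
    MemHInfty (value (S P C N)) := by
  obtain ⟨c, hc⟩ := exists_inv_one_add_smul_map_apply RatFunc.C (P * C) (isHermitian_L N)
    (fun i => (h _ (eigenvalues_L_mem N i)).1) 0
  have hS : S P C N = ∑ i, RatFunc.C (c i) *
      (1 / (1 + RatFunc.C ((isHermitian_L N).eigenvalues i) * (P * C))) := hc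
  rw [hS]
  exact MemHInfty.value_sum _ _ fun i _ =>
    (MemHInfty.value_C _).value_mul (h _ (eigenvalues_L_mem N i)).2

/-! ### The logarithmic integral of a linear factor -/

section LogIntegral

/-- A primitive of `u ↦ log (u² + x²) / 2`. For `x = 0` the arctangent term is `0` and this is the
primitive `u log |u| - u` of `log |u|`. -/
noncomputable def logPrimitive (x u : ℝ) : ℝ :=
  u * (Real.log (u ^ 2 + x ^ 2) / 2) - u + x * Real.arctan (u / x)

theorem logPrimitive_neg (x u : ℝ) : logPrimitive x (-u) = -logPrimitive x u := by
  simp only [logPrimitive, neg_div, Real.arctan_neg, neg_sq]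
  ring

theorem integral_half_log_sq_add_sq {x : ℝ} (hx : 0 ≤ x) (α β : ℝ) :
    ∫ u in α..β, Real.log (u ^ 2 + x ^ 2) / 2 = logPrimitive x β - logPrimitive x α := by
  rcases hx.eq_or_lt with rfl | hx
  · have : (fun u : ℝ => Real.log (u ^ 2 + 0 ^ 2) / 2) = Real.log := by
      funext u
      simp
    simp only [logPrimitive]
    rw [this, integral_log]
    simp
    ring
  · have hpos : ∀ u : ℝ, u ^ 2 + x ^ 2 ≠ 0 := fun u => by positivity
    refine intervalIntegral.integral_eq_sub_of_hasDerivAt (fun u _ => ?_) ?_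
    · have h1 : HasDerivAt (fun u : ℝ => u ^ 2 + x ^ 2) (2 * u) u := by
        simpa using (hasDerivAt_pow 2 u).add_const (x ^ 2)
      have h2 := (hasDerivAt_id u).mul ((h1.log (hpos u)).div_const 2)
      have h3 := (((hasDerivAt_id u).div_const x).arctan).const_mul x
      refine ((h2.sub (hasDerivAt_id u)).add h3).congr_deriv ?_
      have := hpos u
      simp only [id]
      have h4 : 1 + (u / x) ^ 2 = (u ^ 2 + x ^ 2) / x ^ 2 := by field_simp; ring
      rw [h4]
      field_simp
      ring
    · refine Continuous.intervalIntegrable ?_ _ _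
      exact (Continuous.log (by fun_prop) hpos).div_const 2

/-- The shift by `c` enters the asymptotics of the primitive only through `c log R`, so that it
drops out when the expansions for `c` and `-c` are added. -/
theorem tendsto_logPrimitive {x : ℝ} (hx : 0 ≤ x) (c : ℝ) :
    Tendsto (fun R : ℝ => logPrimitive x (R + c) - (R * Real.log R - R) - c * Real.log R) atTop
      (𝓝 (Real.pi / 2 * x)) := by
  -- `(R + c)² + x² = R² (1 + g R)` with `R g(R) → 2c`.
  set g : ℝ → ℝ := fun R => ((R + c) ^ 2 + x ^ 2) / R ^ 2 - 1 with hg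
  have hinv := tendsto_inv_atTop_zero (𝕜 := ℝ)
  have hRg : Tendsto (fun R => R * g R) atTop (𝓝 (2 * c)) := by
    have h1 : Tendsto (fun R : ℝ => 2 * c + (c ^ 2 + x ^ 2) * R⁻¹) atTop (𝓝 (2 * c)) := by
      simpa using (hinv.const_mul (c ^ 2 + x ^ 2)).const_add (2 * c)
    refine h1.congr' ?_
    filter_upwards [eventually_gt_atTop 0] with R hR
    simp only [hg]
    field_simp
    ring
  have hRlog := Real.tendsto_mul_log_one_add_of_tendsto hRg
  have hlog : Tendsto (fun R => Real.log (1 + g R)) atTop (𝓝 0) := by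
    have := hinv.mul hRlog
    rw [zero_mul] at this
    refine this.congr' ?_
    filter_upwards [eventually_gt_atTop 0] with R hR
    field_simp
  have harc : Tendsto (fun R : ℝ => x * Real.arctan ((R + c) / x)) atTop (𝓝 (Real.pi / 2 * x)) := by
    rcases hx.eq_or_lt with rfl | hx
    · simp
    · rw [mul_comm]
      refine Tendsto.const_mul x ?_
      refine (tendsto_nhdsWithin_iff.mp Real.tendsto_arctan_atTop).1.comp ?_
      exact (tendsto_atTop_add_const_right _ c tendsto_id).atTop_div_const hx
  have hsum := ((hRlog.div_const 2).add ((hlog.const_mul (c / 2)))).add (harc.sub_const c)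
  have : 2 * c / 2 + c / 2 * 0 + (Real.pi / 2 * x - c) = Real.pi / 2 * x := by ring
  rw [this] at hsum
  refine hsum.congr' ?_
  filter_upwards [eventually_gt_atTop 0, eventually_gt_atTop (-c)] with R hR hRc
  have hpos : (0 : ℝ) < (R + c) ^ 2 + x ^ 2 := by
    have : 0 < R + c := by linarith
    positivity
  have h1 : Real.log (1 + g R) = Real.log ((R + c) ^ 2 + x ^ 2) - 2 * Real.log R := by
    simp only [hg]
    rw [add_sub_cancel, Real.log_div hpos.ne' (by positivity), Real.log_pow]
    norm_num
  rw [h1, logPrimitive]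
  ring

theorem log_norm_I_mul_sub (a : ℂ) (ω : ℝ) :
    Real.log ‖Complex.I * ω - a‖ = Real.log ((ω - a.im) ^ 2 + (-a.re) ^ 2) / 2 := by
  rw [Complex.norm_def, Real.log_sqrt (Complex.normSq_nonneg _), Complex.normSq_apply]
  congr 2
  simp
  ring

/-- Each linear factor with its root in the closed left half plane contributes `-π Re a`, up to a
divergent term which does not depend on the root. -/
theorem tendsto_integral_log_norm_I_mul_sub {a : ℂ} (ha : a.re ≤ 0) :
    Tendsto (fun R : ℝ => (∫ ω in -R..R, Real.log ‖Complex.I * ω - a‖) -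
      (2 * R * Real.log R - 2 * R)) atTop (𝓝 (-Real.pi * a.re)) := by
  have hx : 0 ≤ -a.re := by linarith
  have h := (tendsto_logPrimitive hx a.im).add (tendsto_logPrimitive hx (-a.im))
  have : Real.pi / 2 * -a.re + Real.pi / 2 * -a.re = -Real.pi * a.re := by ring
  rw [this] at h
  refine h.congr fun R => ?_
  simp only [log_norm_I_mul_sub]
  rw [intervalIntegral.integral_comp_sub_right
    (fun u => Real.log (u ^ 2 + (-a.re) ^ 2) / 2) a.im, integral_half_log_sq_add_sq hx,
    show -R - a.im = -(R + a.im) by ring, logPrimitive_neg, sub_eq_add_neg R a.im]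
  ring

end LogIntegral

/-! ### Bode's integral for a quotient of monic polynomials -/

section Bode

theorem ae_eval_I_mul_ne_zero {p : Polynomial ℂ} (hp : p ≠ 0) :
    ∀ᵐ ω : ℝ, p.eval (Complex.I * ω) ≠ 0 := by
  have hinj : Function.Injective fun ω : ℝ => Complex.I * (ω : ℂ) := fun a b hab =>
    Complex.ofReal_injective (mul_left_cancel₀ Complex.I_ne_zero hab)
  have hfin : {ω : ℝ | p.eval (Complex.I * ω) = 0}.Finite := by
    have := (Finset.finite_toSet p.roots.toFinset).preimage (hinj.injOn (s := univ) |>.mono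
      (subset_univ ((fun ω : ℝ => Complex.I * (ω : ℂ)) ⁻¹' (p.roots.toFinset : Set ℂ))))
    refine this.subset fun ω hω => ?_
    simpa [hp] using hω
  exact measure_eq_zero_iff_ae_notMem.mp (hfin.measure_zero volume)

theorem intervalIntegrable_log_norm_eval (p : Polynomial ℂ) (a b : ℝ) :
    IntervalIntegrable (fun ω : ℝ => Real.log ‖p.eval (Complex.I * ω)‖) volume a b := by
  have : MeromorphicOn (fun ω : ℝ => p.eval (Complex.I * (ω : ℂ))) (uIcc a b) := by
    intro ω _
    have h1 : AnalyticAt ℝ (fun ω : ℝ => Complex.I * (ω : ℂ)) ω :=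
      analyticAt_const.mul (Complex.ofRealCLM.analyticAt ω)
    have h2 : AnalyticAt ℝ (fun z : ℂ => p.eval z) (Complex.I * (ω : ℂ)) :=
      (AnalyticAt.aeval_polynomial (A := ℂ) (analyticAt_id (𝕜 := ℂ)) p).restrictScalars
    exact (h2.comp_of_eq h1 rfl).meromorphicAt
  exact this.intervalIntegrable_log_norm

theorem tendsto_integral_log_norm_prod (t : Multiset ℂ) (ht : ∀ a ∈ t, a.re ≤ 0) :
    Tendsto (fun R : ℝ =>
      (∫ ω in -R..R, Real.log
        ‖(t.map fun a => Polynomial.X - Polynomial.C a).prod.eval (Complex.I * ω)‖) -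
      t.card * (2 * R * Real.log R - 2 * R)) atTop (𝓝 (-Real.pi * t.sum.re)) := by
  induction t using Multiset.induction_on with
  | empty => simp
  | cons a t ih =>
    have h1 := ih fun b hb => ht b (Multiset.mem_cons_of_mem hb)
    have h2 := tendsto_integral_log_norm_I_mul_sub (ht a (Multiset.mem_cons_self a t))
    have h3 := h2.add h1
    rw [Multiset.sum_cons, Complex.add_re, mul_add]
    refine h3.congr fun R => ?_
    set P := (t.map fun a => Polynomial.X - Polynomial.C a).prod
    have hP0 : P ≠ 0 := (Polynomial.monic_multiset_prod_of_monic _ _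
      fun b _ => Polynomial.monic_X_sub_C b).ne_zero
    have hint : IntervalIntegrable (fun ω : ℝ => Real.log ‖Complex.I * ω - a‖) volume (-R) R := by
      have := intervalIntegrable_log_norm_eval (Polynomial.X - Polynomial.C a) (-R) R
      simpa only [Polynomial.eval_sub, Polynomial.eval_X, Polynomial.eval_C] using this
    have heq : ∫ ω in -R..R, Real.log ‖((Polynomial.X - Polynomial.C a) * P).eval (Complex.I * ω)‖ =
        (∫ ω in -R..R, Real.log ‖Complex.I * ω - a‖) +
          ∫ ω in -R..R, Real.log ‖P.eval (Complex.I * ω)‖ := by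
      rw [← intervalIntegral.integral_add hint (intervalIntegrable_log_norm_eval P _ _)]
      refine intervalIntegral.integral_congr_ae ?_
      filter_upwards [ae_eval_I_mul_ne_zero hP0,
        ae_eval_I_mul_ne_zero (Polynomial.X_sub_C_ne_zero a)] with ω h1 h2 _
      rw [Polynomial.eval_mul, norm_mul, Real.log_mul (norm_ne_zero_iff.mpr h2)
        (norm_ne_zero_iff.mpr h1)]
      simp
    rw [Multiset.map_cons, Multiset.prod_cons, heq, Multiset.card_cons]
    push_cast
    ring

/-- Vieta: the sum of the roots is minus the second coefficient. -/
theorem tendsto_integral_log_norm_eval {p : Polynomial ℂ} (hp : p.Monic)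
    (hroots : ∀ a ∈ p.roots, a.re ≤ 0) :
    Tendsto (fun R : ℝ => (∫ ω in -R..R, Real.log ‖p.eval (Complex.I * ω)‖) -
      p.natDegree * (2 * R * Real.log R - 2 * R)) atTop (𝓝 (Real.pi * p.nextCoeff.re)) := by
  have hsplit := IsAlgClosed.splits p
  have h := tendsto_integral_log_norm_prod p.roots hroots
  rw [← hsplit.eq_prod_roots_of_monic hp, ← hsplit.natDegree_eq_card_roots] at h
  rwa [hsplit.nextCoeff_eq_neg_sum_roots_of_monic hp, Complex.neg_re, mul_neg, ← neg_mul]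

theorem log_norm_eval₂_neg (p : Polynomial ℝ) (ω : ℝ) :
    Real.log ‖p.eval₂ (algebraMap ℝ ℂ) (Complex.I * ((-ω : ℝ) : ℂ))‖ =
      Real.log ‖p.eval₂ (algebraMap ℝ ℂ) (Complex.I * ω)‖ := by
  have : p.eval₂ (algebraMap ℝ ℂ) (Complex.I * ((-ω : ℝ) : ℂ)) =
      (starRingEnd ℂ) (p.eval₂ (algebraMap ℝ ℂ) (Complex.I * ω)) := by
    rw [Polynomial.hom_eval₂]
    congr 1
    · ext r; simp
    · simp
  rw [this, RCLike.norm_conj]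

/-- At high frequencies `log ‖p‖ - log ‖q‖ = log ‖1 + (p - q) / q‖`, and `(p - q) / q` decays
quadratically. -/
theorem isBigO_log_norm_sub_log_norm {p q : Polynomial ℂ} (hq : q ≠ 0)
    (hdeg : (p - q).degree + 2 ≤ q.degree) :
    (fun ω : ℝ => Real.log ‖p.eval (Complex.I * ω)‖ - Real.log ‖q.eval (Complex.I * ω)‖)
      =O[atTop] fun ω : ℝ => ω ^ (-2 : ℝ) := by
  have hI : Tendsto (fun ω : ℝ => Complex.I * (ω : ℂ)) atTop (Bornology.cobounded ℂ) := by
    rw [← tendsto_norm_atTop_iff_cobounded]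
    simpa using tendsto_abs_atTop_atTop
  have hX : (Polynomial.X ^ 2 * (p - q)).degree ≤ q.degree := by
    rwa [Polynomial.degree_mul, Polynomial.degree_X_pow, add_comm]
  obtain ⟨K, hK0, hK⟩ :=
    ((Polynomial.isBigO_cobounded_of_degree_le hX).comp_tendsto hI).exists_pos
  have hK := hK.bound
  have hq0 : ∀ᶠ ω : ℝ in atTop, q.eval (Complex.I * ω) ≠ 0 := by
    have hfin := (Finset.finite_toSet q.roots.toFinset).isBounded
    have := hI.eventually (Bornology.isBounded_def.mp hfin)
    filter_upwards [this] with ω hω h0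
    exact hω (by simpa [hq] using h0)
  have hbig : ∀ᶠ ω : ℝ in atTop, 2 * K ≤ ω ^ 2 :=
    (tendsto_pow_atTop two_ne_zero).eventually_ge_atTop _
  refine Asymptotics.IsBigO.of_bound (3 / 2 * K) ?_
  filter_upwards [hK, hq0, hbig, eventually_gt_atTop 0] with ω h1 h2 h3 hω
  set z : ℂ := (p - q).eval (Complex.I * ω) / q.eval (Complex.I * ω) with hz
  have hqpos : 0 < ‖q.eval (Complex.I * ω)‖ := norm_pos_iff.mpr h2
  have hzle : ‖z‖ ≤ K / ω ^ 2 := by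
    simp only [Function.comp, Polynomial.eval_mul, Polynomial.eval_pow, Polynomial.eval_X,
      norm_mul, norm_pow, Complex.norm_I, one_mul, Complex.norm_real, Real.norm_eq_abs,
      sq_abs] at h1
    rw [hz, norm_div, div_le_div_iff₀ hqpos (by positivity)]
    linarith
  have hzhalf : ‖z‖ ≤ 1 / 2 := by
    refine hzle.trans ?_
    rw [div_le_div_iff₀ (by positivity) two_pos]
    linarith
  have hp : p.eval (Complex.I * ω) = q.eval (Complex.I * ω) * (1 + z) := by
    rw [hz, Polynomial.eval_sub]
    field_simp
    ring
  have hone : (1 + z) ≠ 0 := by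
    intro h0
    have : z = -1 := by linear_combination h0
    rw [this, norm_neg, norm_one] at hzhalf
    norm_num at hzhalf
  rw [hp, norm_mul, Real.log_mul hqpos.ne' (norm_ne_zero_iff.mpr hone), add_sub_cancel_left,
    ← Complex.log_re, Real.rpow_neg hω.le, Real.rpow_two, norm_inv, norm_pow, Real.norm_eq_abs,
    Real.norm_eq_abs, sq_abs, mul_assoc, ← div_eq_mul_inv]
  exact (Complex.abs_re_le_norm _).trans ((Complex.norm_log_one_add_half_le_self hzhalf).trans
    (by gcongr))

theorem integrableOn_log_norm_sub_log_norm {p q : Polynomial ℂ} (hq : q ≠ 0)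
    (hdeg : (p - q).degree + 2 ≤ q.degree) :
    IntegrableOn (fun ω : ℝ =>
      Real.log ‖p.eval (Complex.I * ω)‖ - Real.log ‖q.eval (Complex.I * ω)‖) (Ioi 0) := by
  have hloc : LocallyIntegrable (fun ω : ℝ =>
      Real.log ‖p.eval (Complex.I * ω)‖ - Real.log ‖q.eval (Complex.I * ω)‖) := by
    rw [locallyIntegrable_iff]
    intro k hk
    obtain ⟨R, hR⟩ := hk.isBounded.subset_closedBall 0
    rw [Real.closedBall_eq_Icc] at hR
    refine IntegrableOn.mono_set ?_ (hR.trans Icc_subset_uIcc)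
    exact (intervalIntegrable_iff' (by simp)).mp ((intervalIntegrable_log_norm_eval p _ _).sub
      (intervalIntegrable_log_norm_eval q _ _))
  refine ((hloc.locallyIntegrableOn (Ici 0)).integrableOn_of_isBigO_atTop
    (isBigO_log_norm_sub_log_norm hq hdeg) ?_).mono_set Ioi_subset_Ici_self
  exact ⟨Ioi 1, Ioi_mem_atTop 1, integrableOn_Ioi_rpow_of_lt (by norm_num) one_pos⟩

/-- Bode's integral for `p / q`, where `p` and `q` have all roots in the closed left half plane and
differ by a polynomial of degree at most `deg q - 2`: the divergent parts cancel because the degrees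
agree, and the finite parts cancel because the sums of the roots agree. -/
theorem integral_log_norm_sub_log_norm {p q : Polynomial ℝ} (hp : p.Monic) (hq : q.Monic)
    (hnat : p.natDegree = q.natDegree) (hdeg : (p - q).degree + 2 ≤ q.degree)
    (hp0 : ∀ s : ℂ, 0 < s.re → p.eval₂ (algebraMap ℝ ℂ) s ≠ 0)
    (hq0 : ∀ s : ℂ, 0 < s.re → q.eval₂ (algebraMap ℝ ℂ) s ≠ 0) :
    IntegrableOn (fun ω : ℝ => Real.log ‖p.eval₂ (algebraMap ℝ ℂ) (Complex.I * ω)‖ -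
      Real.log ‖q.eval₂ (algebraMap ℝ ℂ) (Complex.I * ω)‖) (Ioi 0) ∧
    ∫ ω in Ioi (0 : ℝ), (Real.log ‖p.eval₂ (algebraMap ℝ ℂ) (Complex.I * ω)‖ -
      Real.log ‖q.eval₂ (algebraMap ℝ ℂ) (Complex.I * ω)‖) = 0 := by
  have hroots : ∀ r : Polynomial ℝ, (∀ s : ℂ, 0 < s.re → r.eval₂ (algebraMap ℝ ℂ) s ≠ 0) →
      ∀ a ∈ (r.map (algebraMap ℝ ℂ)).roots, a.re ≤ 0 := by
    intro r hr a ha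
    by_contra hcon
    push Not at hcon
    refine hr a hcon ?_
    rw [← Polynomial.eval_map]
    exact (Polynomial.mem_roots'.mp ha).2
  have hnext : p.nextCoeff = q.nextCoeff := by
    by_cases h0 : q.natDegree = 0
    · simp [Polynomial.nextCoeff, h0, hnat]
    · rw [Polynomial.nextCoeff_of_natDegree_pos (by omega),
        Polynomial.nextCoeff_of_natDegree_pos (by omega), hnat, ← sub_eq_zero,
        ← Polynomial.coeff_sub]
      refine Polynomial.coeff_eq_zero_of_degree_lt ?_
      by_cases hpq : p - q = 0
      · rw [hpq, Polynomial.degree_zero]; exact WithBot.bot_lt_coe _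
      · rw [Polynomial.degree_eq_natDegree hpq, Polynomial.degree_eq_natDegree hq.ne_zero] at hdeg
        rw [Polynomial.degree_eq_natDegree hpq]
        have : (p - q).natDegree + 2 ≤ q.natDegree := by exact_mod_cast hdeg
        exact_mod_cast (by omega : (p - q).natDegree < q.natDegree - 1)
  have hint : IntegrableOn (fun ω : ℝ => Real.log ‖p.eval₂ (algebraMap ℝ ℂ) (Complex.I * ω)‖ -
      Real.log ‖q.eval₂ (algebraMap ℝ ℂ) (Complex.I * ω)‖) (Ioi 0) := by
    have := integrableOn_log_norm_sub_log_norm (hq.map (algebraMap ℝ ℂ)).ne_zero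
      (p := p.map (algebraMap ℝ ℂ)) (by
        rwa [← Polynomial.map_sub, Polynomial.degree_map, Polynomial.degree_map])
    simpa only [Polynomial.eval_map] using this
  refine ⟨hint, ?_⟩
  have hlim := (tendsto_integral_log_norm_eval (hp.map (algebraMap ℝ ℂ)) (hroots p hp0)).sub
    (tendsto_integral_log_norm_eval (hq.map (algebraMap ℝ ℂ)) (hroots q hq0))
  rw [Polynomial.nextCoeff_map (algebraMap ℝ ℂ).injective,
    Polynomial.nextCoeff_map (algebraMap ℝ ℂ).injective, hnext, sub_self] at hlim
  have hhalf := intervalIntegral_tendsto_integral_Ioi 0 hint tendsto_id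
  have heven : ∀ R : ℝ, ∫ ω in -R..R,
      (Real.log ‖p.eval₂ (algebraMap ℝ ℂ) (Complex.I * ω)‖ -
        Real.log ‖q.eval₂ (algebraMap ℝ ℂ) (Complex.I * ω)‖) =
      2 * ∫ ω in (0 : ℝ)..R, (Real.log ‖p.eval₂ (algebraMap ℝ ℂ) (Complex.I * ω)‖ -
        Real.log ‖q.eval₂ (algebraMap ℝ ℂ) (Complex.I * ω)‖) := by
    intro R
    have hI : ∀ a b : ℝ, IntervalIntegrable (fun ω : ℝ =>
        Real.log ‖p.eval₂ (algebraMap ℝ ℂ) (Complex.I * ω)‖ -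
        Real.log ‖q.eval₂ (algebraMap ℝ ℂ) (Complex.I * ω)‖) volume a b := fun a b => by
      simpa only [Polynomial.eval_map] using
        (intervalIntegrable_log_norm_eval (p.map (algebraMap ℝ ℂ)) a b).sub
          (intervalIntegrable_log_norm_eval (q.map (algebraMap ℝ ℂ)) a b)
    rw [← intervalIntegral.integral_add_adjacent_intervals (hI (-R) 0) (hI 0 R), two_mul]
    congr 1
    have := intervalIntegral.integral_comp_neg (a := -R) (b := 0) (fun ω : ℝ =>
        Real.log ‖p.eval₂ (algebraMap ℝ ℂ) (Complex.I * ω)‖ -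
        Real.log ‖q.eval₂ (algebraMap ℝ ℂ) (Complex.I * ω)‖)
    simp only [log_norm_eval₂_neg, neg_neg, neg_zero] at this
    exact this
  have hzero : Tendsto (fun R : ℝ => 2 * ∫ ω in (0 : ℝ)..R,
      (Real.log ‖p.eval₂ (algebraMap ℝ ℂ) (Complex.I * ω)‖ -
        Real.log ‖q.eval₂ (algebraMap ℝ ℂ) (Complex.I * ω)‖)) atTop (𝓝 0) := by
    refine hlim.congr fun R => ?_
    rw [← heven, intervalIntegral.integral_sub, Polynomial.natDegree_map, Polynomial.natDegree_map,
      hnat]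
    · simp only [Polynomial.eval_map]
      ring
    · simpa only [Polynomial.eval_map] using
        intervalIntegrable_log_norm_eval (p.map (algebraMap ℝ ℂ)) (-R) R
    · simpa only [Polynomial.eval_map] using
        intervalIntegrable_log_norm_eval (q.map (algebraMap ℝ ℂ)) (-R) R
  have := tendsto_nhds_unique hzero (hhalf.const_mul 2)
  linarith

end Bode

/-! ### The sensitivity function of the string -/

section StringSensitivity

theorem RelativeDegreeAtLeast.integral_log_closedLoop {G : TransferFunction}
    (hG : RelativeDegreeAtLeast 2 G)
    (h : ∀ k ∈ Ioo (0 : ℝ) 4, ∀ s : ℂ, 0 < s.re →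
      (closedLoop G k).eval₂ (algebraMap ℝ ℂ) s ≠ 0) {k : ℝ} (hk : k ∈ Ioo (0 : ℝ) 4) :
    IntegrableOn (fun ω : ℝ =>
      Real.log ‖(closedLoop G k).eval₂ (algebraMap ℝ ℂ) (Complex.I * ω)‖ -
      Real.log ‖G.denom.eval₂ (algebraMap ℝ ℂ) (Complex.I * ω)‖) (Ioi 0) ∧
    ∫ ω in Ioi (0 : ℝ), (Real.log ‖(closedLoop G k).eval₂ (algebraMap ℝ ℂ) (Complex.I * ω)‖ -
      Real.log ‖G.denom.eval₂ (algebraMap ℝ ℂ) (Complex.I * ω)‖) = 0 := by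
  refine integral_log_norm_sub_log_norm (hG.closedLoop_monic k) G.monic_denom
    (hG.closedLoop_natDegree k) ?_ (h k hk) fun s hs => denom_eval₂_ne_zero_of_closedLoop hG h hs
  rw [closedLoop, add_sub_cancel_left]
  exact hG.degree_num_lt k

theorem S_eq_prod_div_prod {P C : TransferFunction}
    (h : ∀ k ∈ Ioo (0 : ℝ) 4, 1 + RatFunc.C k * (P * C) ≠ 0) (n : ℕ) :
    S P C (n + 1) =
      algebraMap _ (RatFunc ℝ) ((P * C).denom *
        ∏ j, closedLoop (P * C) ((isHermitian_L_minor n).eigenvalues j)) /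
      algebraMap _ (RatFunc ℝ)
        (∏ i, closedLoop (P * C) ((isHermitian_L (n + 1)).eigenvalues i)) := by
  have hdet : (returnDifference P C (n + 1)).det ≠ 0 := by
    rw [det_returnDifference]
    exact Finset.prod_ne_zero_iff.mpr fun i _ => h _ (eigenvalues_L_mem _ i)
  have hS := S_mul_prod_eigenvalues P C n hdet
  have hq : algebraMap _ (RatFunc ℝ)
      (∏ i, closedLoop (P * C) ((isHermitian_L (n + 1)).eigenvalues i)) ≠ 0 :=
    RatFunc.algebraMap_ne_zero (Finset.prod_ne_zero_iff.mpr fun i _ =>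
      closedLoop_ne_zero (h _ (eigenvalues_L_mem _ i)))
  rw [eq_div_iff hq, map_mul, map_prod, map_prod]
  simp only [← one_add_C_mul_mul_denom, Finset.prod_mul_distrib, Finset.prod_const,
    Finset.card_univ, Fintype.card_fin]
  rw [← mul_assoc, hS, pow_succ]
  ring

/-- `log ‖S_N‖` along the imaginary axis, off the finitely many zeros of the polynomials involved.
The numbers of factors in `∏ T_{λ_i}` and `∏ T_{μ_j}` differ by one, which accounts for the factor `d`
in `S_eq_prod_div_prod`. -/
theorem log_norm_value_S_ae {P C : TransferFunction}
    (h : ∀ k ∈ Ioo (0 : ℝ) 4, 1 + RatFunc.C k * (P * C) ≠ 0) (n : ℕ) :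
    ∀ᵐ ω : ℝ, Real.log ‖value (S P C (n + 1)) (Complex.I * ω)‖ =
      (∑ j, (Real.log ‖(closedLoop (P * C)
          ((isHermitian_L_minor n).eigenvalues j)).eval₂ (algebraMap ℝ ℂ) (Complex.I * ω)‖ -
        Real.log ‖(P * C).denom.eval₂ (algebraMap ℝ ℂ) (Complex.I * ω)‖)) -
      ∑ i, (Real.log ‖(closedLoop (P * C)
          ((isHermitian_L (n + 1)).eigenvalues i)).eval₂ (algebraMap ℝ ℂ) (Complex.I * ω)‖ -
        Real.log ‖(P * C).denom.eval₂ (algebraMap ℝ ℂ) (Complex.I * ω)‖) := by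
  have hae : ∀ p : Polynomial ℝ, p ≠ 0 →
      ∀ᵐ ω : ℝ, p.eval₂ (algebraMap ℝ ℂ) (Complex.I * ω) ≠ 0 := by
    intro p hp
    have := ae_eval_I_mul_ne_zero
      ((Polynomial.map_ne_zero_iff (algebraMap ℝ ℂ).injective).mpr hp)
    simpa only [Polynomial.eval_map] using this
  have hq0 : ∏ i, closedLoop (P * C) ((isHermitian_L (n + 1)).eigenvalues i) ≠ 0 :=
    Finset.prod_ne_zero_iff.mpr fun i _ => closedLoop_ne_zero (h _ (eigenvalues_L_mem _ i))
  have hcross := (RatFunc.num_mul_eq_mul_denom_iff hq0).mpr (S_eq_prod_div_prod h n)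
  filter_upwards [hae _ (P * C).denom_ne_zero, hae _ (S P C (n + 1)).denom_ne_zero,
    ae_all_iff.mpr fun i => hae _ (closedLoop_ne_zero (h _ (eigenvalues_L_mem (n + 1) i))),
    ae_all_iff.mpr fun j => hae _ (closedLoop_ne_zero (h _ (eigenvalues_L_minor_mem n j)))]
    with ω hd hSd hl hm
  have hev := congrArg (Polynomial.eval₂ (algebraMap ℝ ℂ) (Complex.I * ω)) hcross
  simp only [Polynomial.eval₂_mul, Polynomial.eval₂_finsetProd] at hev
  have hlp := Finset.prod_ne_zero_iff.mpr fun i (_ : i ∈ Finset.univ) => hl i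
  have hval : value (S P C (n + 1)) (Complex.I * ω) = _ :=
    (div_eq_div_iff hSd hlp).mpr hev
  rw [hval, norm_div, norm_mul, norm_prod, norm_prod, Real.log_div, Real.log_mul, Real.log_prod,
    Real.log_prod, Finset.sum_sub_distrib, Finset.sum_sub_distrib]
  · simp only [Finset.sum_const, Finset.card_univ, Fintype.card_fin, nsmul_eq_mul]
    push_cast
    ring
  · exact fun i _ => norm_ne_zero_iff.mpr (hl i)
  · exact fun j _ => norm_ne_zero_iff.mpr (hm j)
  · exact norm_ne_zero_iff.mpr hd
  · exact Finset.prod_ne_zero_iff.mpr fun j _ => norm_ne_zero_iff.mpr (hm j)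
  · exact mul_ne_zero (norm_ne_zero_iff.mpr hd)
      (Finset.prod_ne_zero_iff.mpr fun j _ => norm_ne_zero_iff.mpr (hm j))
  · exact Finset.prod_ne_zero_iff.mpr fun i _ => norm_ne_zero_iff.mpr (hl i)

end StringSensitivity

end StringNetwork

theorem theorem2 (P C : StringNetwork.TransferFunction)
    (h : ∀ k : ℝ, k ∈ Ioo (0 : ℝ) 4 →
      1 + RatFunc.C k * (P * C) ≠ 0 ∧
      StringNetwork.MemHInfty
        (StringNetwork.value (1 / (1 + RatFunc.C k * (P * C))))) :
    (∀ (N : ℕ) [NeZero N],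
      (StringNetwork.returnDifference P C N).det ≠ 0 ∧
      StringNetwork.MemHInfty (StringNetwork.value (StringNetwork.S P C N))) ∧
    (StringNetwork.RelativeDegreeAtLeast 2 (P * C) →
      ∀ (N : ℕ) [NeZero N],
        IntegrableOn
          (fun ω : ℝ => Real.log
            ‖StringNetwork.value (StringNetwork.S P C N) (Complex.I * (ω : ℂ))‖) (Ioi 0) ∧
        ∫ ω in Ioi (0 : ℝ), Real.log
          ‖StringNetwork.value (StringNetwork.S P C N) (Complex.I * (ω : ℂ))‖ = 0) := by
  refine ⟨fun N _ => ⟨?_, StringNetwork.memHInfty_S h N⟩, fun hdeg N _ => ?_⟩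
  · rw [StringNetwork.det_returnDifference]
    exact Finset.prod_ne_zero_iff.mpr fun i _ => (h _ (StringNetwork.eigenvalues_L_mem N i)).1
  · obtain ⟨n, rfl⟩ := Nat.exists_eq_succ_of_ne_zero (NeZero.ne N)
    have hroot : ∀ k ∈ Ioo (0 : ℝ) 4, ∀ s : ℂ, 0 < s.re →
        (StringNetwork.closedLoop (P * C) k).eval₂ (algebraMap ℝ ℂ) s ≠ 0 := fun k hk _ hs =>
      StringNetwork.closedLoop_eval₂_ne_zero hk.1.ne' (h k hk).1 (h k hk).2 hs
    have hbode := fun {k : ℝ} (hk : k ∈ Ioo (0 : ℝ) 4) => hdeg.integral_log_closedLoop hroot hk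
    have hae := ae_restrict_of_ae (s := Ioi (0 : ℝ))
      (StringNetwork.log_norm_value_S_ae (fun k hk => (h k hk).1) n)
    have hm := fun j => hbode (StringNetwork.eigenvalues_L_minor_mem n j)
    have hl := fun i => hbode (StringNetwork.eigenvalues_L_mem (n + 1) i)
    have hmi := integrable_finsetSum Finset.univ fun j _ => (hm j).1
    have hli := integrable_finsetSum Finset.univ fun i _ => (hl i).1
    refine ⟨(hmi.sub hli).congr (hae.mono fun ω hω => hω.symm), ?_⟩
    refine (integral_congr_ae hae).trans ?_
    rw [integral_sub hmi hli, integral_finsetSum _ fun j _ => (hm j).1,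
      integral_finsetSum _ fun i _ => (hl i).1]
    simp [fun j => (hm j).2, fun i => (hl i).2]
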